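/- **Conventions.** All groups are abelian; $\tilde G=\mathbb{Q}\otimes G$ is the divisible hull of a torsion-free group $G$. A torsion-free group $G$ of finite rank is *almost completely decomposable* if it has a subgroup of finite index which is completely decomposable (a direct sum of finitely many torsion-free groups of rank 1). Its *regulator* $A=\mathrm{Reg}\,G$ is the intersection of all completely decomposable subgroups of least index; $A$ is completely decomposable. For a type $\tau$, $A_\tau=\mathrm{Reg}_\tau G$ is the sum of the rank-one summands of type $\tau$ in a fixed decomposition of $A$ into rank-one summands, and $T=T(G)=\{\tau\mid A_\tau\neq 0\}$. $G$ is *block-rigid* if the types in $T$ are pairwise incomparable, *rigid* if moreover every $A_\tau$ ($\tau\in T$) has rank 1, *of ring type* if all types in $T$ are idempotent, and a *CRQ-group* if $G/A$ is cyclic. $\mathcal{A}_0$ is the class of block-rigid almost completely decomposable CRQ-groups of ring type. For an idempotent type $\tau$, $P_\infty(\tau)$ is the set of primes $p$ with $\tau(p)=\infty$, $R_\tau$ is the unital subring of $\mathbb{Q}$ whose additive group has type $\tau$, and a $P_0(\tau)$-number is a nonzero integer with no prime divisor in $P_\infty(\tau)$. For $G\in\mathcal{A}_0$ write $G=\langle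 d,A\rangle$. For $\tau\in T$, $m_\tau=m_\tau(G)$ is the order of $\pi_\tau(d)+A$ in $\tilde A/A$, where $\pi_\tau$ is the projection of $\tilde G=\bigoplus_{\sigma\in T}\tilde A_\sigma$ onto $\tilde A_\tau$ (it does not depend on $d$), and $T_0=\{\tau\in T\mid m_\tau>1\}$. A *main decomposition* is $G=G_1\oplus C$ with $C$ block-rigid completely decomposable and $G_1$ a rigid CRQ-group with $T(G_1)=T_0$ and $m_\tau(G_1)=m_\tau(G)$ for $\tau\in T_0$; fix one. An *rc-basis* of $G$, defined by an element $d\in G_1$ with $G=\langle d,A\rangle$, is a system $E_0=\{e_\tau\in \mathrm{Reg}_\tau G_1\mid\tau\in T_0\}$ with $\mathrm{Reg}\,G_1=\bigoplus_{\tau\in T_0}R_\tau e_\tau$ and $$d=\sum_{\tau\in T_0}\frac{s_\tau}{m_\tau}e_\tau ,$$ where $s_\tau,m_\tau$ are coprime integers and $P_0(\tau)$-numbers for every $\tau\in T_0$. If $G$ is rigid, an *r-basis* extending $E_0$ is a system $E=\{e_\tau\in A_\tau\mid \tau\in T\}$ containing $E_0$ with $A=\bigoplus_{\tau\in T}R_\tau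 e_\tau$. For a rigid $G\in\mathcal{A}_0$ let $$M_G(E_0)=\langle X\rangle+\prod_{\tau\in T}m_\tau^2A_\tau,\qquad X=(m_\tau s_\tau^{-1}e_\tau)_{\tau\in T_0},$$ where $s_\tau^{-1}$ is an integer inverse to $s_\tau$ modulo $m_\tau$ and the coordinates of $X$ outside $T_0$ are $0$. In the ring $R_G=\prod_{\tau\in T}R_\tau$ consider the subring $K_G=\mathbb{Z}1_{T_0}+\prod_{\tau\in T}m_\tau R_\tau$, where $1_{T_0}$ has coordinates $1$ on $T_0$ and $0$ elsewhere, and let $K_G^*$ be its group of units; $R_G$ acts on $\prod_{\tau\in T}\mathbb{Q}e_\tau$ coordinatewise. $\mathrm{Mult}\,G=\mathrm{Hom}(G\otimes G,G)$ is the group of multiplications on $G$; for $\times\in\mathrm{Mult}\,G$, $(G,\times)$ is the corresponding (not necessarily associative) ring. **Theorem 2.4 (The isomorphism theorem).** Let $G$ be a rigid group in $\mathcal{A}_0$ with an rc-basis $E_0$, and let $E=\{e_\tau\mid\tau\in T\}$ be an r-basis of $G$ extending $E_0$. Then $\times\mapsto U_\times=(e_\tau\times e_\tau)_{\tau\in T}$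 is an isomorphism of $\mathrm{Mult}\,G$ onto $M_G(E_0)$. If elements $U_*,U_\times\in M_G(E_0)$ determine in this way the rings $(G,*)$ and $(G,\times)$, respectively, then $(G,*)\cong(G,\times)$ if and only if there is an element $c\in K_G^*$ such that $U_*=cU_\times$. -/

import Mathlib

namespace ACDGroup

open scoped TensorProduct

/-! ### Heights, characteristics, types -/

/-- The `p`-height of `x` in the abelian group `G`, with value `⊤` if `x` is divisible by all powers
of `p`. -/
noncomputable def height {G : Type*} [AddCommGroup G] (x : G) (p : Nat.Primes) : ℕ∞ :=
  ⨆ k : {k : ℕ // ∃ y : G, ((p : ℕ) ^ k) • y = x}, ((k : ℕ) : ℕ∞)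

/-- Two characteristics are equivalent if they differ at finitely many primes only, and only at
primes where both of them are finite. -/
instance charSetoid : Setoid (Nat.Primes → ℕ∞) where
  r χ ψ := {p | χ p ≠ ψ p}.Finite ∧ ∀ p, χ p ≠ ψ p → χ p ≠ ⊤ ∧ ψ p ≠ ⊤
  iseqv :=
    { refl := fun χ => by simp
      symm := fun {χ ψ} h =>
        ⟨h.1.subset fun p hp => Ne.symm hp, fun p hp => (h.2 p (Ne.symm hp)).symm⟩
      trans := fun {χ ψ φ} h h' => by
        refine ⟨(h.1.union h'.1).subset fun p hp => ?_, fun p hp => ?_⟩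
        · simp only [Set.mem_union, Set.mem_ofPred_eq] at hp ⊢
          by_contra hc
          push Not at hc
          exact hp (hc.1.trans hc.2)
        · by_cases h1 : χ p = ψ p
          · by_cases h2 : ψ p = φ p
            · exact absurd (h1.trans h2) hp
            · exact ⟨h1 ▸ (h'.2 p h2).1, (h'.2 p h2).2⟩
          · by_cases h2 : ψ p = φ p
            · exact ⟨(h.2 p h1).1, h2 ▸ (h.2 p h1).2⟩
            · exact ⟨(h.2 p h1).1, (h'.2 p h2).2⟩ }

/-- Types (in the sense of torsion-free abelian groups): classes of equivalent characteristics. -/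
def GType : Type := Quotient charSetoid

/-- The type of an element of a group. -/
noncomputable def typeOf {G : Type*} [AddCommGroup G] (x : G) : GType :=
  Quotient.mk charSetoid (height x)

/-- The order of types: `τ ≤ σ` if some characteristic in `τ` is pointwise at most some
characteristic in `σ`. -/
def GType.le (τ σ : GType) : Prop :=
  ∃ χ ψ : Nat.Primes → ℕ∞, Quotient.mk charSetoid χ = τ ∧ Quotient.mk charSetoid ψ = σ ∧
    ∀ p, χ p ≤ ψ p

/-- A type is idempotent if it contains a characteristic with values `0` and `∞` only. -/
def GType.IsIdempotent (τ : GType) : Prop :=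
  ∃ χ : Nat.Primes → ℕ∞, Quotient.mk charSetoid χ = τ ∧ ∀ p, χ p = 0 ∨ χ p = ⊤

/-- `P_∞(τ) = {p | τ(p) = ∞}`. -/
def GType.PInf (τ : GType) : Set Nat.Primes :=
  Quotient.lift (fun χ : Nat.Primes → ℕ∞ => {p | χ p = ⊤}) (by
    intro χ ψ h
    ext p
    simp only [Set.mem_ofPred_eq]
    by_cases hp : χ p = ψ p
    · rw [hp]
    · exact ⟨fun h1 => absurd h1 (h.2 p hp).1, fun h1 => absurd h1 (h.2 p hp).2⟩) τ

/-- `P_0(τ)`, the complement of `P_∞(τ)`. -/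
def GType.PZero (τ : GType) : Set Nat.Primes := τ.PInfᶜ

/-- A `P`-number: a nonzero integer all of whose prime divisors are in `P`. -/
def IsPNumber (P : Set Nat.Primes) (n : ℤ) : Prop :=
  n ≠ 0 ∧ ∀ p : Nat.Primes, ((p : ℕ) : ℤ) ∣ n → p ∈ P

/-- `R_τ`: for an idempotent type `τ`, the unital subring of `ℚ` whose additive group has type `τ`,
that is, the fractions whose denominator has prime divisors in `P_∞(τ)` only. -/
def GType.R (τ : GType) : Subring ℚ where
  carrier := {q | ∀ p : Nat.Primes, (p : ℕ) ∣ q.den → p ∈ τ.PInf}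
  mul_mem' {a b} ha hb p hp :=
    ((Nat.Prime.dvd_mul p.2).1 (hp.trans (Rat.mul_den_dvd a b))).elim (ha p) (hb p)
  one_mem' p hp := absurd (Nat.dvd_one.1 hp) p.2.one_lt.ne'
  add_mem' {a b} ha hb p hp :=
    ((Nat.Prime.dvd_mul p.2).1 (hp.trans (Rat.add_den_dvd a b))).elim (ha p) (hb p)
  zero_mem' p hp := absurd (Nat.dvd_one.1 hp) p.2.one_lt.ne'
  neg_mem' {a} ha p hp := ha p (by simpa using hp)

/-! ### Completely decomposable and almost completely decomposable groups -/

/-- Torsion-free groups of rank one. -/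
def IsRankOne (X : Type*) [AddCommGroup X] : Prop :=
  IsAddTorsionFree X ∧ Module.rank ℤ X = 1

/-- The type of a torsion-free group of rank one is the common type of its nonzero elements. -/
def HasType (X : Type*) [AddCommGroup X] (τ : GType) : Prop :=
  ∀ x : X, x ≠ 0 → typeOf x = τ

/-- A decomposition of `A` into the direct sum of finitely many torsion-free subgroups of rank 1. -/
structure CompleteDecomposition (A : Type*) [AddCommGroup A] where
  k : ℕ
  summand : Fin k → AddSubgroup A
  isInternal : DirectSum.IsInternal summand
  rankOne : ∀ i, IsRankOne (summand i)

/-- The sum of the rank one summands of type `τ` in a complete decomposition. -/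
def CompleteDecomposition.part {A : Type*} [AddCommGroup A] (D : CompleteDecomposition A)
    (τ : GType) : AddSubgroup A :=
  ⨆ i : {i : Fin D.k // HasType (D.summand i) τ}, D.summand i

/-- Completely decomposable groups (of finite rank). -/
def IsCD (A : Type*) [AddCommGroup A] : Prop := Nonempty (CompleteDecomposition A)

/-- Almost completely decomposable groups: torsion-free groups of finite rank with a completely
decomposable subgroup of finite index. -/
structure IsACD (G : Type*) [AddCommGroup G] : Prop where
  torsionFree : IsAddTorsionFree G
  finiteRank : Module.rank ℤ G < Cardinal.aleph0
  exists_cd : ∃ H : AddSubgroup G, IsCD H ∧ H.FiniteIndex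

/-- A completely decomposable subgroup of (finite) least index. -/
def IsRegulating {G : Type*} [AddCommGroup G] (H : AddSubgroup G) : Prop :=
  IsCD H ∧ H.FiniteIndex ∧ ∀ H' : AddSubgroup G, IsCD H' → H'.FiniteIndex → H.index ≤ H'.index

/-- The regulator `Reg G`: the intersection of all completely decomposable subgroups of least
index. -/
def regulator (G : Type*) [AddCommGroup G] : AddSubgroup G :=
  sInf {H : AddSubgroup G | IsRegulating H}

open Classical in
/-- `Reg_τ G`: the sum of the rank one summands of type `τ` in a fixed complete decomposition of the
(completely decomposable) group `Reg G`. -/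
noncomputable def regPart (G : Type*) [AddCommGroup G] (τ : GType) : AddSubgroup G :=
  if h : IsCD (regulator G) then ((Classical.choice h).part τ).map (regulator G).subtype else ⊥

/-- The set `T(G)` of critical types. -/
def critTypes (G : Type*) [AddCommGroup G] : Set GType := {τ | regPart G τ ≠ ⊥}

/-- Helper: there are only finitely many critical types, so that sums over them make sense. -/
theorem critTypes_finite (G : Type*) [AddCommGroup G] : (critTypes G).Finite := by
  classical
  by_cases h : IsCD (regulator G)
  · refine Set.Finite.subset (Set.finite_range fun i : Fin (Classical.choice h).k =>
      if hx : ∃ x : (Classical.choice h).summand i, x ≠ 0 then typeOf hx.choose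
      else typeOf (0 : G)) ?_
    intro τ hτ
    simp only [critTypes, regPart, dif_pos h, Set.mem_ofPred_eq] at hτ
    by_cases hi : Nonempty {i : Fin (Classical.choice h).k //
        HasType ((Classical.choice h).summand i) τ}
    · obtain ⟨i, hi⟩ := hi
      refine ⟨i, ?_⟩
      have hx : ∃ x : (Classical.choice h).summand i, x ≠ 0 := by
        have hr := ((Classical.choice h).rankOne i).2
        by_contra hc
        push Not at hc
        have : Subsingleton ((Classical.choice h).summand i) :=
          ⟨fun a b => (hc a).trans (hc b).symm⟩
        rw [rank_subsingleton'] at hr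
        exact zero_ne_one hr
      simp only [dif_pos hx]
      exact hi _ hx.choose_spec
    · exfalso
      apply hτ
      have := not_nonempty_iff.1 hi
      rw [CompleteDecomposition.part, iSup_of_empty, AddSubgroup.map_bot]
  · convert Set.finite_empty
    ext τ
    simp [critTypes, regPart, h]

/-- Block-rigid groups: the critical types are pairwise incomparable. -/
def IsBlockRigid (G : Type*) [AddCommGroup G] : Prop :=
  ∀ τ ∈ critTypes G, ∀ σ ∈ critTypes G, τ ≠ σ → ¬ τ.le σ

/-- Rigid groups: block-rigid, and every `Reg_τ G` with `τ` critical has rank 1. -/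
def IsRigid (G : Type*) [AddCommGroup G] : Prop :=
  IsBlockRigid G ∧ ∀ τ ∈ critTypes G, Module.rank ℤ (regPart G τ) = 1

/-- Groups of ring type: all critical types are idempotent. -/
def IsRingType (G : Type*) [AddCommGroup G] : Prop :=
  ∀ τ ∈ critTypes G, τ.IsIdempotent

/-- CRQ-groups: almost completely decomposable groups with cyclic regulator quotient. -/
def IsCRQ (G : Type*) [AddCommGroup G] : Prop :=
  IsACD G ∧ IsAddCyclic (G ⧸ regulator G)

/-- The class `𝒜₀` of block-rigid almost completely decomposable groups of ring type with cyclic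
regulator quotient. -/
structure InA0 (G : Type*) [AddCommGroup G] : Prop where
  crq : IsCRQ G
  blockRigid : IsBlockRigid G
  ringType : IsRingType G

/-! ### The divisible hull and the invariants `m_τ` -/

/-- The divisible hull of a torsion-free group. -/
abbrev Hull (G : Type*) [AddCommGroup G] : Type _ := ℚ ⊗[ℤ] G

/-- The canonical embedding of (torsion-free) `G` into its divisible hull. -/
noncomputable def toHull (G : Type*) [AddCommGroup G] : G →+ Hull G :=
  (TensorProduct.mk ℤ ℚ G 1).toAddMonoidHom

/-- The divisible hull of `Reg_τ G` inside the one of `G`. -/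
noncomputable def hullPart (G : Type*) [AddCommGroup G] (τ : GType) : Submodule ℚ (Hull G) :=
  Submodule.span ℚ (toHull G '' (regPart G τ : Set G))

open Classical in
/-- The projection of the divisible hull of `G` onto the divisible hull of `Reg_τ G`, along the sum
of the hulls for the other critical types. -/
noncomputable def proj (G : Type*) [AddCommGroup G] (τ : GType) : Hull G →ₗ[ℚ] Hull G :=
  if h : IsCompl (hullPart G τ) (⨆ σ ∈ critTypes G \ {τ}, hullPart G σ) then
    Submodule.projection _ _ h else 0

/-- `d` represents a generator of the regulator quotient: `G = ⟨d, Reg G⟩`. -/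
def IsRegGenerator {G : Type*} [AddCommGroup G] (d : G) : Prop :=
  AddSubgroup.zmultiples d ⊔ regulator G = ⊤

open Classical in
/-- The invariant `m_τ(G)`: the order of `π_τ(d) + A` in `Ã / A`, where `A = Reg G` and
`G = ⟨d, A⟩`; it does not depend on the choice of `d`. -/
noncomputable def mInv (G : Type*) [AddCommGroup G] (τ : GType) : ℕ :=
  if h : ∃ d : G, IsRegGenerator d then
    addOrderOf (QuotientAddGroup.mk (proj G τ (toHull G h.choose)) :
      Hull G ⧸ (regulator G).map (toHull G))
  else 0

/-- `T_0(G)`, the set of critical types with `m_τ > 1`. -/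
def critTypes₀ (G : Type*) [AddCommGroup G] : Set GType := {τ | τ ∈ critTypes G ∧ 1 < mInv G τ}

/-- A main decomposition `G = G₁ ⊕ C`. -/
structure IsMainDecomposition {G : Type*} [AddCommGroup G] (G₁ C : AddSubgroup G) : Prop where
  isCompl : IsCompl G₁ C
  cd : IsCD C
  blockRigid : IsBlockRigid C
  crq : IsCRQ G₁
  rigid : IsRigid G₁
  critTypes_eq : critTypes G₁ = critTypes₀ G
  mInv_eq : ∀ τ ∈ critTypes G₁, mInv G₁ τ = mInv G τ

/-! ### Bases -/

/-- The cyclic `R_τ`-submodule `R_τ e` of the divisible hull of `G`. -/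
noncomputable def cyc {G : Type*} [AddCommGroup G] (τ : GType) (e : G) : AddSubgroup (Hull G) :=
  τ.R.toAddSubgroup.map (LinearMap.toSpanSingleton ℚ (Hull G) (toHull G e)).toAddMonoidHom

/-- `e₀` is an rc-basis of `G`, relative to the main decomposition with first summand `G₁`, defined
by the element `d`, and `s` is the family of numerators in the standard representation
`d = ∑ (s_τ / m_τ) e₀^(τ)`. -/
structure IsRCBasis {G : Type*} [AddCommGroup G] (G₁ : AddSubgroup G) (d : G)
    (e₀ : critTypes₀ G → G) (s : critTypes₀ G → ℤ) : Prop where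
  mem_G₁ : d ∈ G₁
  generator : IsRegGenerator d
  mem_part : ∀ τ : critTypes₀ G, e₀ τ ∈ (regPart G₁ (τ : GType)).map G₁.subtype
  independent : iSupIndep fun τ : critTypes₀ G => cyc (τ : GType) (e₀ τ)
  sum_eq : ⨆ τ : critTypes₀ G, cyc (τ : GType) (e₀ τ) =
    ((regulator G₁).map G₁.subtype).map (toHull G)
  standard_rep : toHull G d =
    ∑ᶠ τ : critTypes₀ G, ((s τ : ℚ) / (mInv G τ : ℚ)) • toHull G (e₀ τ)
  coprime : ∀ τ : critTypes₀ G, IsCoprime (s τ) (mInv G τ : ℤ)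
  s_number : ∀ τ : critTypes₀ G, IsPNumber (τ : GType).PZero (s τ)
  m_number : ∀ τ : critTypes₀ G, IsPNumber (τ : GType).PZero (mInv G τ : ℤ)

/-- `e` is an r-basis of the rigid group `G` which extends the rc-basis `e₀`. -/
structure IsRBasis {G : Type*} [AddCommGroup G] (e : critTypes G → G) (e₀ : critTypes₀ G → G) :
    Prop where
  mem_part : ∀ τ : critTypes G, e τ ∈ regPart G (τ : GType)
  independent : iSupIndep fun τ : critTypes G => cyc (τ : GType) (e τ)
  sum_eq : ⨆ τ : critTypes G, cyc (τ : GType) (e τ) = (regulator G).map (toHull G)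
  extends_rc : ∀ τ : critTypes₀ G, e ⟨τ, τ.2.1⟩ = e₀ τ

/-! ### The group `M_G(E₀)` of a rigid group -/

open Classical in
/-- The element `X = (m_τ s_τ⁻¹ e_τ)`, over `τ ∈ T_0`, with `s_τ⁻¹` an integer that is inverse to
`s_τ` modulo `m_τ`; the coordinates outside of `T_0` are `0`. -/
noncomputable def elemX {G : Type*} [AddCommGroup G] (e₀ : critTypes₀ G → G)
    (s : critTypes₀ G → ℤ) : critTypes G → G := fun τ =>
  if h : (τ : GType) ∈ critTypes₀ G then
    (mInv G τ * ((s ⟨τ, h⟩ : ZMod (mInv G τ))⁻¹).val) • e₀ ⟨τ, h⟩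
  else 0

/-- `M^(2) = ∏ m_τ² A_τ`, over all `τ ∈ T(G)`, where `A_τ = Reg_τ G`. -/
noncomputable def subgroupM2 (G : Type*) [AddCommGroup G] : AddSubgroup (critTypes G → G) :=
  AddSubgroup.pi Set.univ fun τ => (regPart G τ).map (nsmulAddMonoidHom (mInv G τ ^ 2))

/-- `M_G(E₀) = ⟨X, M^(2)⟩`. -/
noncomputable def groupM {G : Type*} [AddCommGroup G] (e₀ : critTypes₀ G → G)
    (s : critTypes₀ G → ℤ) : AddSubgroup (critTypes G → G) :=
  AddSubgroup.zmultiples (elemX e₀ s) ⊔ subgroupM2 G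

/-! ### The ring `K_G` -/

/-- The ring `R_G = ∏ R_τ`, over all `τ ∈ T(G)`. -/
abbrev RingR (G : Type*) [AddCommGroup G] : Type := ∀ τ : critTypes G, (τ : GType).R

open Classical in
/-- The element `1_{T_0}` of `R_G`. -/
noncomputable def oneT₀ (G : Type*) [AddCommGroup G] : RingR G := fun τ =>
  if (τ : GType) ∈ critTypes₀ G then 1 else 0

/-- `K_G = ℤ 1_{T_0} + ∏ m_τ R_τ`. (As `m_τ = 1` for `τ ∉ T_0`, it contains the identity of
`R_G`.) -/
noncomputable def ringK (G : Type*) [AddCommGroup G] : AddSubgroup (RingR G) :=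
  AddSubgroup.zmultiples (oneT₀ G) ⊔
    AddSubgroup.pi Set.univ fun τ : critTypes G =>
      (nsmulAddMonoidHom (α := (τ : GType).R) (mInv G τ)).range

/-- The multiplicative group `K_G^*`: the elements of `K_G` with an inverse in `K_G`. -/
def unitsK (G : Type*) [AddCommGroup G] : Set (RingR G) :=
  {c | c ∈ ringK G ∧ ∃ c' ∈ ringK G, c * c' = 1}

/-! ### Multiplications -/

/-- The group `Mult G` of multiplications on `G`. -/
abbrev Mult (G : Type*) [AddCommGroup G] : Type _ := G ⊗[ℤ] G →ₗ[ℤ] G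

/-- The (not necessarily associative) rings `(G, μ)` and `(G, ν)` are isomorphic. -/
def RingsIsomorphic {G : Type*} [AddCommGroup G] (μ ν : Mult G) : Prop :=
  ∃ f : G ≃+ G, ∀ x y : G, f (μ (x ⊗ₜ[ℤ] y)) = ν (f x ⊗ₜ[ℤ] f y)

/-- The homomorphism which takes a multiplication `×` on `G` to the element
`U = (e_τ × e_τ)`, `τ ∈ T(G)`. -/
def multVector {G : Type*} [AddCommGroup G] (e : critTypes G → G) :
    Mult G →+ (critTypes G → G) where
  toFun μ := fun τ => μ (e τ ⊗ₜ[ℤ] e τ)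
  map_zero' := rfl
  map_add' _ _ := rfl

end ACDGroup

open ACDGroup

/-!
In the coordinates given by an r-basis `e` of the regulator `A`, the group `G` becomes
`ℤ (s_τ / m_τ)_τ + ∏ R_τ`. An endomorphism preserves divisibility by the primes of `P_∞(τ)`, so it
is diagonal because the types are pairwise incomparable; a diagonal matrix `c` respects `G` exactly
if `c_τ ≡ k` modulo `m_τ R_τ` for a common integer `k`, which is the definition of `K_G`. In the
same way a multiplication is determined by the squares `e_τ × e_τ = u_τ e_τ`, and the only
conditions on `u` are those coming from `d × e_τ` and `d × d`, which define `M_G(E₀)`. An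
isomorphism given by the diagonal matrix `c` multiplies `u` by `c`.

The coordinates are only useful because `A` contains the pure hulls of the `e_τ`: every rank one
summand of a regulating subgroup lies in one of these hulls, so that the direct sum of the hulls
is the only regulating subgroup.
-/

namespace ACDGroup

open scoped TensorProduct

/-! ### Idempotent types and their rings -/

theorem GType.le_of_pInf_subset {τ σ : GType} (hτ : τ.IsIdempotent) (hσ : σ.IsIdempotent)
    (h : τ.PInf ⊆ σ.PInf) : τ.le σ := by
  obtain ⟨χ, rfl, hχ⟩ := hτ
  obtain ⟨ψ, rfl, -⟩ := hσ
  refine ⟨χ, ψ, rfl, rfl, fun p => ?_⟩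
  rcases hχ p with h_zero | h_top
  · simp [h_zero]
  · have : ψ p = ⊤ := h (show χ p = ⊤ from h_top)
    simp [this]

theorem GType.inv_prime_pow_mem_R {τ : GType} {p : Nat.Primes} (hp : p ∈ τ.PInf) (k : ℕ) :
    (((p : ℕ) : ℚ) ^ k)⁻¹ ∈ τ.R := by
  rw [← inv_pow]
  refine pow_mem (fun q hq => ?_) k
  rw [Rat.inv_natCast_den_of_pos p.2.pos] at hq
  rwa [show q = p from Subtype.ext ((Nat.prime_dvd_prime_iff_eq q.2 p.2).1 hq)]

theorem GType.mem_pInf_of_forall_pow_mul_eq {τ : GType} {p : Nat.Primes} {q : ℚ} (hq : q ≠ 0)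
    (h : ∀ k : ℕ, ∃ r ∈ τ.R, ((p : ℕ) : ℚ) ^ k * r = q) : p ∈ τ.PInf := by
  by_contra hp
  have : Fact (p : ℕ).Prime := ⟨p.2⟩
  obtain ⟨r, hr, hrq⟩ := h ((padicValRat p q).toNat + 1)
  have hp0 : ((p : ℕ) : ℚ) ≠ 0 := by exact_mod_cast p.2.ne_zero
  have hr0 : r ≠ 0 := by rintro rfl; exact hq (by rw [← hrq, mul_zero])
  have hr_val : 0 ≤ padicValRat p r := by
    rw [padicValRat, padicValNat.eq_zero_of_not_dvd fun hd => hp (hr p hd)]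
    simp
  have hq_val : padicValRat p q = (padicValRat p q).toNat + 1 + padicValRat p r := by
    conv_lhs => rw [← hrq]
    rw [padicValRat.mul (pow_ne_zero _ hp0) hr0, padicValRat.pow, padicValRat.self p.2.one_lt]
    push_cast
    ring
  have := Int.self_le_toNat (padicValRat p q)
  lia

theorem div_mem_of_isCoprime {R : Subring ℚ} {s m : ℤ} (hsm : IsCoprime s m) (hm : m ≠ 0) {x : ℚ}
    (hx : x ∈ R) (h : x * (s / m) ∈ R) : x / m ∈ R := by
  obtain ⟨a, b, hab⟩ := hsm
  have hm' : (m : ℚ) ≠ 0 := by exact_mod_cast hm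
  have hab' : (a : ℚ) * s + b * m = 1 := by exact_mod_cast hab
  have hxm : x / m = a * (x * (s / m)) + b * x := by
    field_simp
    linear_combination (-x) * hab'
  rw [hxm]
  exact add_mem (mul_mem (intCast_mem _ a) h) (mul_mem (intCast_mem _ b) hx)

/-- Pairwise incomparability of a family of types, expressed by the sets `P_∞(t i)`: for idempotent
types `τ ≤ σ` means `P_∞(τ) ⊆ P_∞(σ)`. -/
def IsRigidFamily {T : Type*} (t : T → GType) : Prop :=
  Pairwise fun i j => ¬ (t i).PInf ⊆ (t j).PInf

theorem IsBlockRigid.isRigidFamily {G : Type*} [AddCommGroup G] (hb : IsBlockRigid G)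
    (hr : IsRingType G) : IsRigidFamily fun τ : critTypes G => (τ : GType) :=
  fun τ σ hτσ h => hb τ τ.2 σ σ.2 (Subtype.coe_ne_coe.2 hτσ)
    (GType.le_of_pInf_subset (hr τ τ.2) (hr σ σ.2) h)

/-! ### Divisibility -/

/-- Divisibility of an element by all powers of all primes in `P`. For `P = P_∞(τ)` this is the only
trace of the type `τ` of an element that the proof uses. -/
def IsDivisibleBy {G : Type*} [AddCommGroup G] (P : Set Nat.Primes) (g : G) : Prop :=
  ∀ p ∈ P, ∀ k : ℕ, ∃ y : G, ((p : ℕ) ^ k) • y = g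

section Divisibility

variable {G H : Type*} [AddCommGroup G] [AddCommGroup H] {P : Set Nat.Primes}

theorem isDivisibleBy_zero : IsDivisibleBy P (0 : G) :=
  fun _ _ _ => ⟨0, smul_zero _⟩

theorem IsDivisibleBy.add {g h : G} (hg : IsDivisibleBy P g) (hh : IsDivisibleBy P h) :
    IsDivisibleBy P (g + h) := fun p hp k => by
  obtain ⟨x, rfl⟩ := hg p hp k
  obtain ⟨y, rfl⟩ := hh p hp k
  exact ⟨x + y, smul_add _ _ _⟩

theorem IsDivisibleBy.map {g : G} (hg : IsDivisibleBy P g) (f : G →+ H) : IsDivisibleBy P (f g) :=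
  fun p hp k => by
    obtain ⟨y, rfl⟩ := hg p hp k
    exact ⟨f y, (map_nsmul f _ _).symm⟩

theorem exists_pow_smul_eq_of_height_eq_top {x : G} {p : Nat.Primes} (h : height x p = ⊤) (k : ℕ) :
    ∃ y : G, ((p : ℕ) ^ k) • y = x := by
  obtain ⟨⟨l, y, rfl⟩, hkl⟩ := lt_iSup_iff.1 (h ▸ ENat.natCast_lt_top k : (k : ℕ∞) < height x p)
  have hkl : k ≤ l := by exact_mod_cast hkl.le
  exact ⟨(p : ℕ) ^ (l - k) • y, by rw [smul_smul, ← pow_add, Nat.add_sub_cancel' hkl]⟩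

theorem HasType.isDivisibleBy {τ : GType} (h : HasType G τ) (x : G) : IsDivisibleBy τ.PInf x := by
  rcases eq_or_ne x 0 with rfl | hx
  · exact isDivisibleBy_zero
  · rw [← h x hx]
    exact fun p hp => exists_pow_smul_eq_of_height_eq_top hp

end Divisibility

/-! ### Coordinates with respect to a basis of a subgroup -/

section Hull

variable {G : Type*} [AddCommGroup G]

theorem toHull_injective [IsAddTorsionFree G] : Function.Injective (toHull G) := by
  rw [injective_iff_map_eq_zero]
  intro g hg
  obtain ⟨c, hc⟩ := (IsLocalizedModule.eq_zero_iff (nonZeroDivisors ℤ)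
    (TensorProduct.mk ℤ ℚ G 1)).1 hg
  exact (smul_eq_zero.1 (show (c : ℤ) • g = 0 from hc)).resolve_left (nonZeroDivisors.coe_ne_zero c)

theorem exists_nsmul_mem_map_toHull {A : AddSubgroup G} (hA : ∃ N : ℕ, N ≠ 0 ∧ ∀ g : G, N • g ∈ A)
    (x : Hull G) : ∃ n : ℕ, n ≠ 0 ∧ n • x ∈ A.map (toHull G) := by
  obtain ⟨N, hN0, hN⟩ := hA
  induction x using TensorProduct.induction_on with
  | zero => exact ⟨1, one_ne_zero, by simp⟩
  | tmul q g =>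
    refine ⟨N * q.den, mul_ne_zero hN0 q.den_nz, N • q.num • g, hN _, ?_⟩
    have hq : q.den • q = (q.num : ℚ) := by rw [nsmul_eq_mul, mul_comm, Rat.mul_den_eq_num]
    rw [map_nsmul, mul_smul, TensorProduct.smul_tmul', hq, map_zsmul, ← zsmul_one,
      ← TensorProduct.smul_tmul']
    rfl
  | add x y hx hy =>
    obtain ⟨k, hk, hkx⟩ := hx
    obtain ⟨l, hl, hly⟩ := hy
    refine ⟨k * l, mul_ne_zero hk hl, ?_⟩
    rw [smul_add, mul_comm, mul_smul, mul_comm, mul_smul]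
    exact add_mem (nsmul_mem hkx l) (nsmul_mem hly k)

theorem mem_cyc {τ : GType} {e : G} {x : Hull G} : x ∈ cyc τ e ↔ ∃ r ∈ τ.R, r • toHull G e = x :=
  Iff.rfl

theorem toHull_mem_cyc (τ : GType) (e : G) : toHull G e ∈ cyc τ e :=
  mem_cyc.2 ⟨1, one_mem _, one_smul _ _⟩

theorem cyc_eq_bot_iff [IsAddTorsionFree G] {τ : GType} {e : G} : cyc τ e = ⊥ ↔ e = 0 := by
  refine ⟨fun h => toHull_injective ?_, ?_⟩
  · rw [map_zero, ← AddSubgroup.mem_bot, ← h]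
    exact toHull_mem_cyc τ e
  · rintro rfl
    refine (AddSubgroup.eq_bot_iff_forall _).2 ?_
    rintro _ ⟨r, -, rfl⟩
    simp

end Hull

/-- The elements `e i` form a basis of the subgroup `A` with coefficients in the rings `R_{t i}`,
that is, `A = ⨁ R_{t i} e i` in the divisible hull of `G`, and `G / A` has finite exponent. -/
structure IsRingBasis {G T : Type*} [AddCommGroup G] (t : T → GType) (e : T → G)
    (A : AddSubgroup G) : Prop where
  ne_zero : ∀ i, e i ≠ 0
  independent : iSupIndep fun i => cyc (t i) (e i)
  iSup_cyc : ⨆ i, cyc (t i) (e i) = A.map (toHull G)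
  exists_nsmul_mem : ∃ N : ℕ, N ≠ 0 ∧ ∀ g : G, N • g ∈ A

namespace IsRingBasis

variable {G : Type*} [AddCommGroup G] [IsAddTorsionFree G] {T : Type*} {t : T → GType} {e : T → G}
  {A : AddSubgroup G}

theorem linearIndependent (h : IsRingBasis t e A) :
    LinearIndependent ℚ fun i => toHull G (e i) := by
  rw [← LinearIndependent.iff_fractionRing ℤ ℚ]
  have : Module.IsTorsionFree ℤ (Hull G) := Module.IsTorsionFree.trans_faithfulSMul ℤ ℚ _
  exact (h.independent.map_orderIso AddSubgroup.toIntSubmodule).linearIndependent _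
    (fun i => toHull_mem_cyc (t i) (e i))
    fun i hi => h.ne_zero i (toHull_injective (hi.trans (map_zero _).symm))

omit [IsAddTorsionFree G] in
theorem top_le_span (h : IsRingBasis t e A) :
    ⊤ ≤ Submodule.span ℚ (Set.range fun i => toHull G (e i)) := by
  have hcyc : ∀ i, cyc (t i) (e i) ≤
      (Submodule.span ℚ (Set.range fun i => toHull G (e i))).toAddSubgroup := by
    intro i x hx
    obtain ⟨r, -, rfl⟩ := mem_cyc.1 hx
    exact Submodule.smul_mem _ _ (Submodule.subset_span ⟨i, rfl⟩)
  rintro x -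
  obtain ⟨n, hn, hx⟩ := exists_nsmul_mem_map_toHull h.exists_nsmul_mem x
  rw [← h.iSup_cyc, ← Nat.cast_smul_eq_nsmul ℚ] at hx
  exact (Submodule.smul_mem_iff _ (Nat.cast_ne_zero.2 hn)).1 (iSup_le hcyc hx)

/-- The basis of the divisible hull of `G` which is given by the `e i`. -/
noncomputable def hullBasis (h : IsRingBasis t e A) : Module.Basis T ℚ (Hull G) :=
  Module.Basis.mk h.linearIndependent h.top_le_span

@[simp]
theorem hullBasis_apply (h : IsRingBasis t e A) (i : T) : h.hullBasis i = toHull G (e i) :=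
  Module.Basis.mk_apply _ _ i

/-- The rational coordinates of the elements of `G` with respect to the `e i`. -/
noncomputable def coord (h : IsRingBasis t e A) : G →+ (T → ℚ) :=
  AddMonoidHom.pi fun i => (h.hullBasis.coord i).toAddMonoidHom.comp (toHull G)

theorem coord_apply (h : IsRingBasis t e A) (g : G) (i : T) :
    h.coord g i = h.hullBasis.coord i (toHull G g) :=
  rfl

theorem coord_injective (h : IsRingBasis t e A) : Function.Injective h.coord :=
  fun _ _ hxy => toHull_injective (h.hullBasis.ext_elem fun i => congrFun hxy i)

@[simp]
theorem coord_basis_self (h : IsRingBasis t e A) (i : T) : h.coord (e i) i = 1 := by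
  rw [coord_apply, ← h.hullBasis_apply, Module.Basis.coord_apply, Module.Basis.repr_self,
    Finsupp.single_eq_same]

theorem coord_basis_of_ne (h : IsRingBasis t e A) {i j : T} (hj : j ≠ i) :
    h.coord (e i) j = 0 := by
  rw [coord_apply, ← h.hullBasis_apply, Module.Basis.coord_apply, Module.Basis.repr_self,
    Finsupp.single_eq_of_ne hj]

theorem coord_mem_R (h : IsRingBasis t e A) {a : G} (ha : a ∈ A) (i : T) :
    h.coord a i ∈ (t i).R := by
  have hcyc : ∀ j, cyc (t j) (e j) ≤
      (t i).R.toAddSubgroup.comap (h.hullBasis.coord i).toAddMonoidHom := by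
    rintro j _ ⟨r, hr, rfl⟩
    change h.hullBasis.coord i (r • toHull G (e j)) ∈ (t i).R
    rw [map_smul, ← coord_apply, smul_eq_mul]
    rcases eq_or_ne i j with rfl | hij
    · simpa using hr
    · simp [h.coord_basis_of_ne hij]
  have ha' : toHull G a ∈ A.map (toHull G) := AddSubgroup.mem_map_of_mem _ ha
  rw [← h.iSup_cyc] at ha'
  exact iSup_le hcyc ha'

theorem exists_mem_coord_eq [Finite T] (h : IsRingBasis t e A) {v : T → ℚ}
    (hv : ∀ i, v i ∈ (t i).R) : ∃ a ∈ A, h.coord a = v := by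
  have := Fintype.ofFinite T
  have hmem : h.hullBasis.equivFun.symm v ∈ A.map (toHull G) := by
    rw [← h.iSup_cyc, Module.Basis.equivFun_symm_apply]
    refine sum_mem fun i _ => AddSubgroup.mem_iSup_of_mem i ?_
    rw [hullBasis_apply]
    exact mem_cyc.2 ⟨_, hv i, rfl⟩
  obtain ⟨a, ha, hav⟩ := hmem
  refine ⟨a, ha, ?_⟩
  change h.hullBasis.equivFun (toHull G a) = v
  rw [hav, LinearEquiv.apply_symm_apply]

theorem pInf_subset_of_coord_ne_zero (h : IsRingBasis t e A) {P : Set Nat.Primes} {g : G}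
    (hg : IsDivisibleBy P g) {i : T} (hi : h.coord g i ≠ 0) : P ⊆ (t i).PInf := by
  intro p hp
  obtain ⟨N, hN0, hN⟩ := h.exists_nsmul_mem
  refine GType.mem_pInf_of_forall_pow_mul_eq (q := N * h.coord g i)
    (mul_ne_zero (Nat.cast_ne_zero.2 hN0) hi) fun k => ?_
  obtain ⟨y, rfl⟩ := hg p hp k
  refine ⟨h.coord (N • y) i, h.coord_mem_R (hN y) i, ?_⟩
  simp only [map_nsmul, Pi.smul_apply, nsmul_eq_mul, Nat.cast_pow]
  ring

theorem isDivisibleBy_basis (h : IsRingBasis t e A) (i : T) : IsDivisibleBy (t i).PInf (e i) := by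
  intro p hp k
  have hmem : (((p : ℕ) : ℚ) ^ k)⁻¹ • toHull G (e i) ∈ A.map (toHull G) := by
    rw [← h.iSup_cyc]
    exact AddSubgroup.mem_iSup_of_mem i (mem_cyc.2 ⟨_, GType.inv_prime_pow_mem_R hp k, rfl⟩)
  obtain ⟨y, -, hy⟩ := hmem
  refine ⟨y, toHull_injective ?_⟩
  have hp0 : ((p : ℕ) : ℚ) ^ k ≠ 0 := pow_ne_zero _ (Nat.cast_ne_zero.2 p.2.ne_zero)
  rw [map_nsmul, hy, ← Nat.cast_smul_eq_nsmul ℚ, Nat.cast_pow, smul_inv_smul₀ hp0]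

/-- The diagonal entries of an endomorphism of `G` in the coordinates. -/
noncomputable def diagonal (h : IsRingBasis t e A) (f : G →+ G) : T → ℚ :=
  fun i => h.coord (f (e i)) i

theorem coord_map (h : IsRingBasis t e A) (ht : IsRigidFamily t) (f : G →+ G) (g : G) :
    h.coord (f g) = h.diagonal f * h.coord g := by
  funext i
  have hdiag : h.hullBasis.coord i ∘ₗ f.toIntLinearMap.baseChange ℚ =
      h.diagonal f i • h.hullBasis.coord i := by
    refine h.hullBasis.ext fun j => ?_
    rw [hullBasis_apply]
    change h.coord (f (e j)) i = h.diagonal f i * h.coord (e j) i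
    rcases eq_or_ne i j with rfl | hij
    · rw [h.coord_basis_self, mul_one, diagonal]
    · rw [h.coord_basis_of_ne hij, mul_zero]
      by_contra hne
      exact ht hij.symm (h.pInf_subset_of_coord_ne_zero ((h.isDivisibleBy_basis j).map f) hne)
  exact LinearMap.congr_fun hdiag (toHull G g)

/-- The pure hull of `e i` in `G`. -/
noncomputable def pureHull (h : IsRingBasis t e A) (i : T) : AddSubgroup G :=
  (AddSubgroup.pi {i}ᶜ fun _ => ⊥).comap h.coord

theorem mem_pureHull (h : IsRingBasis t e A) {i : T} {g : G} :
    g ∈ h.pureHull i ↔ ∀ j ≠ i, h.coord g j = 0 :=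
  Iff.rfl

theorem basis_mem_pureHull (h : IsRingBasis t e A) (i : T) : e i ∈ h.pureHull i :=
  h.mem_pureHull.2 fun _ => h.coord_basis_of_ne

theorem eq_of_mem_pureHull (h : IsRingBasis t e A) {i : T} {x y : G} (hx : x ∈ h.pureHull i)
    (hy : y ∈ h.pureHull i) (hxy : h.coord x i = h.coord y i) : x = y := by
  refine h.coord_injective (funext fun j => ?_)
  rcases eq_or_ne j i with rfl | hj
  · exact hxy
  · rw [h.mem_pureHull.1 hx j hj, h.mem_pureHull.1 hy j hj]

theorem exists_mem_pureHull_coord_eq [Finite T] (h : IsRingBasis t e A) {i : T} {r : ℚ}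
    (hr : r ∈ (t i).R) : ∃ g ∈ h.pureHull i, h.coord g i = r := by
  classical
  obtain ⟨g, -, hg⟩ := h.exists_mem_coord_eq (v := Pi.single i r) fun j => by
    rcases eq_or_ne j i with rfl | hj
    · rwa [Pi.single_eq_same]
    · rw [Pi.single_eq_of_ne hj]
      exact zero_mem _
  refine ⟨g, h.mem_pureHull.2 fun j hj => ?_, ?_⟩
  · rw [hg, Pi.single_eq_of_ne hj]
  · rw [hg, Pi.single_eq_same]

theorem mem_pureHull_of_zsmul_mem (h : IsRingBasis t e A) {i : T} {g : G} {n : ℤ} (hn : n ≠ 0)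
    (hg : n • g ∈ h.pureHull i) : g ∈ h.pureHull i := h.mem_pureHull.2 fun j hj => by
  have hgj := h.mem_pureHull.1 hg j hj
  rw [map_zsmul] at hgj
  exact (smul_eq_zero.1 hgj).resolve_left hn

theorem mem_pureHull_of_isDivisibleBy (h : IsRingBasis t e A) (ht : IsRigidFamily t) {i : T} {g : G}
    (hg : IsDivisibleBy (t i).PInf g) : g ∈ h.pureHull i := h.mem_pureHull.2 fun j hj => by
  by_contra hne
  exact ht hj.symm (h.pInf_subset_of_coord_ne_zero hg hne)

theorem map_mem_pureHull (h : IsRingBasis t e A) (ht : IsRigidFamily t) (f : G →+ G) {i : T}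
    {g : G} (hg : g ∈ h.pureHull i) : f g ∈ h.pureHull i := h.mem_pureHull.2 fun j hj => by
  rw [h.coord_map ht, Pi.mul_apply, h.mem_pureHull.1 hg j hj, mul_zero]

theorem den_nsmul_eq_num_zsmul_basis (h : IsRingBasis t e A) {i : T} {g : G}
    (hg : g ∈ h.pureHull i) : (h.coord g i).den • g = (h.coord g i).num • e i := by
  refine h.eq_of_mem_pureHull (nsmul_mem hg _) (zsmul_mem (h.basis_mem_pureHull i) _) ?_
  simp [Rat.den_mul_eq_num]

theorem toHull_eq_smul_iff (h : IsRingBasis t e A) {i : T} {x y : G} (hx : x ∈ h.pureHull i)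
    (hy : y ∈ h.pureHull i) {q : ℚ} :
    toHull G x = q • toHull G y ↔ h.coord x i = q * h.coord y i := by
  refine ⟨fun hxy => ?_, fun hxy => h.hullBasis.ext_elem fun j => ?_⟩
  · rw [coord_apply, hxy, map_smul]
    rfl
  · change h.coord x j = _
    rw [map_smul]
    change _ = q * h.coord y j
    rcases eq_or_ne j i with rfl | hj
    · exact hxy
    · rw [h.mem_pureHull.1 hx j hj, h.mem_pureHull.1 hy j hj, mul_zero]

end IsRingBasis

/-! ### Groups of rank one and complete decompositions -/

theorem IsRankOne.nontrivial {X : Type*} [AddCommGroup X] (h : IsRankOne X) : Nontrivial X := by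
  by_contra hX
  have := not_nontrivial_iff_subsingleton.1 hX
  have hrank := h.2
  rw [rank_subsingleton'] at hrank
  exact zero_ne_one hrank

theorem IsRankOne.exists_zsmul_eq {X : Type*} [AddCommGroup X] (h : IsRankOne X) {x : X}
    (hx : x ≠ 0) (y : X) : ∃ n k : ℤ, n ≠ 0 ∧ n • y = k • x := by
  have := h.1
  by_contra! hc
  have hlin : LinearIndependent ℤ ![x, y] := by
    rw [LinearIndependent.pair_iff]
    intro a b hab
    have hb : b = 0 := by
      by_contra hb
      exact hc b (-a) hb (by rw [neg_smul]; exact eq_neg_of_add_eq_zero_right hab)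
    subst hb
    simpa [hx] using hab
  have hrank := hlin.cardinal_lift_le_rank
  rw [h.2] at hrank
  norm_num at hrank

theorem isRankOne_of_injective {X : Type*} [AddCommGroup X] [Nontrivial X] (f : X →+ ℚ)
    (hf : Function.Injective f) : IsRankOne X := by
  have : IsAddTorsionFree X := hf.isAddTorsionFree f
  refine ⟨this, le_antisymm ?_ ?_⟩
  · have hrank : Module.rank ℤ ℚ = 1 := by
      rw [← IsLocalization.rank_eq ℚ (nonZeroDivisors ℤ) le_rfl, Module.rank_self]
    simpa [hrank] using LinearMap.lift_rank_le_of_injective f.toIntLinearMap hf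
  · exact Cardinal.one_le_iff_pos.2 rank_pos

namespace CompleteDecomposition

variable {A : Type*} [AddCommGroup A] (D : CompleteDecomposition A)

/-- The projection onto a rank one summand, as an endomorphism of the whole group. -/
noncomputable def projection (k : Fin D.k) : A →+ A :=
  letI := D.isInternal.chooseDecomposition
  (D.summand k).subtype.comp
    ((DFinsupp.evalAddMonoidHom k).comp (DirectSum.decomposeAddEquiv D.summand).toAddMonoidHom)

theorem projection_mem (k : Fin D.k) (a : A) : D.projection k a ∈ D.summand k :=
  Subtype.property _

theorem projection_of_mem {k : Fin D.k} {a : A} (ha : a ∈ D.summand k) : D.projection k a = a :=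
  letI := D.isInternal.chooseDecomposition
  DirectSum.decompose_of_mem_same D.summand ha

theorem projection_of_mem_of_ne {k l : Fin D.k} {a : A} (ha : a ∈ D.summand k) (hkl : k ≠ l) :
    D.projection l a = 0 :=
  letI := D.isInternal.chooseDecomposition
  DirectSum.decompose_of_mem_ne D.summand ha hkl

theorem sum_projection (a : A) : ∑ k, D.projection k a = a := by
  classical
  let := D.isInternal.chooseDecomposition
  conv_rhs => rw [← DirectSum.sum_support_decompose D.summand a]
  refine (Finset.sum_subset (Finset.subset_univ _) fun k _ hk => ?_).symm
  have hk0 : DirectSum.decompose D.summand a k = 0 := by simpa using hk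
  exact congrArg Subtype.val hk0

theorem mem_part_iff {τ : GType} {a : A} :
    a ∈ D.part τ ↔ ∀ k, ¬ HasType (D.summand k) τ → D.projection k a = 0 := by
  refine ⟨fun ha k hk => ?_, fun ha => ?_⟩
  · have hle : D.part τ ≤ (D.projection k).ker :=
      iSup_le fun i x hx => D.projection_of_mem_of_ne hx fun hik => hk (hik ▸ i.2)
    exact hle ha
  · rw [← D.sum_projection a]
    refine sum_mem fun k _ => ?_
    by_cases hk : HasType (D.summand k) τ
    · exact AddSubgroup.mem_iSup_of_mem (⟨k, hk⟩ : {i // HasType (D.summand i) τ})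
        (D.projection_mem k a)
    · rw [ha k hk]
      exact zero_mem _

theorem mem_part_of_zsmul_mem [IsAddTorsionFree A] {τ : GType} {a : A} {n : ℤ} (hn : n ≠ 0)
    (ha : n • a ∈ D.part τ) : a ∈ D.part τ := D.mem_part_iff.2 fun k hk => by
  have hk0 := D.mem_part_iff.1 ha k hk
  rw [map_zsmul] at hk0
  exact (smul_eq_zero.1 hk0).resolve_left hn

end CompleteDecomposition

theorem isInternal_addSubgroupOf_iSup {G ι : Type*} [AddCommGroup G] [DecidableEq ι]
    {S : ι → AddSubgroup G} (hS : iSupIndep S) :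
    DirectSum.IsInternal fun i => (S i).addSubgroupOf (⨆ i, S i) := by
  let K := ⨆ i, S i
  have hmap : ∀ i, ((S i).addSubgroupOf K).map K.subtype = S i := fun i =>
    AddSubgroup.map_addSubgroupOf_eq_of_le (le_iSup S i)
  have hindep : iSupIndep fun i => (S i).addSubgroupOf K := by
    let Φ : AddSubgroup K ≃o Set.Iic K := AddSubgroup.MapSubtype.orderIso K
    refine (iSupIndep_map_orderIso_iff Φ).1 (iSupIndep.of_coe_Iic_comp ?_)
    rwa [show Subtype.val ∘ Φ ∘ (fun i => (S i).addSubgroupOf K) = S from funext hmap]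
  have htop : ⨆ i, (S i).addSubgroupOf K = ⊤ := by
    refine AddSubgroup.map_injective K.subtype_injective ?_
    simp only [AddSubgroup.map_iSup, hmap]
    rw [← AddMonoidHom.range_eq_map, K.range_subtype]
  refine DirectSum.isInternal_submodule_of_iSupIndep_of_iSup_eq_top
    (hindep.map_orderIso AddSubgroup.toIntSubmodule) ?_
  exact (AddSubgroup.toIntSubmodule.map_iSup _).symm.trans (htop ▸ OrderIso.map_top _)

theorem isCD_iSup {G ι : Type*} [AddCommGroup G] [Finite ι] {S : ι → AddSubgroup G}
    (hS : iSupIndep S) (hrank : ∀ i, IsRankOne (S i)) : IsCD ↥(⨆ i, S i) := by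
  obtain ⟨n, ⟨E⟩⟩ := Finite.exists_equiv_fin ι
  rw [← E.symm.iSup_comp]
  refine ⟨⟨n, _, isInternal_addSubgroupOf_iSup (hS.comp E.symm.injective), fun k => ?_⟩⟩
  let equiv := AddSubgroup.addSubgroupOfEquivOfLe (le_iSup (S ∘ E.symm) k)
  have : IsAddTorsionFree ((S ∘ E.symm) k) := (hrank (E.symm k)).1
  exact ⟨equiv.injective.isAddTorsionFree equiv.toAddMonoidHom,
    equiv.toIntLinearEquiv.rank_eq.trans (hrank (E.symm k)).2⟩

/-! ### The regulator -/

theorem IsACD.exists_isRegulating {G : Type*} [AddCommGroup G] (h : IsACD G) :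
    ∃ H : AddSubgroup G, IsRegulating H := by
  classical
  have hex : ∃ n, ∃ H : AddSubgroup G, IsCD H ∧ H.FiniteIndex ∧ H.index = n := by
    obtain ⟨H, hcd, hfin⟩ := h.exists_cd
    exact ⟨_, H, hcd, hfin, rfl⟩
  obtain ⟨H, hcd, hfin, hindex⟩ := Nat.find_spec hex
  exact ⟨H, hcd, hfin, fun K hK hK' => hindex ▸ Nat.find_min' hex ⟨K, hK, hK', rfl⟩⟩

theorem IsACD.exists_nsmul_mem_regulator {G : Type*} [AddCommGroup G] (h : IsACD G) :
    ∃ N : ℕ, N ≠ 0 ∧ ∀ g : G, N • g ∈ regulator G := by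
  obtain ⟨H, hH⟩ := h.exists_isRegulating
  refine ⟨H.index, hH.2.1.index_ne_zero, fun g => ?_⟩
  rw [regulator, AddSubgroup.mem_sInf]
  intro K hK
  rw [le_antisymm (hH.2.2 K hK.1 hK.2.1) (hK.2.2 H hH.1 hH.2.1)]
  exact K.nsmul_index_mem g

namespace IsRingBasis

variable {G : Type*} [AddCommGroup G] [IsAddTorsionFree G] {T : Type*} {t : T → GType} {e : T → G}
  {A : AddSubgroup G}

theorem iSupIndep_pureHull (h : IsRingBasis t e A) : iSupIndep h.pureHull := by
  intro i
  have hle : ⨆ j, ⨆ _ : j ≠ i, h.pureHull j ≤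
      ((Pi.evalAddMonoidHom (fun _ : T => ℚ) i).comp h.coord).ker :=
    iSup₂_le fun j hj g hg => h.mem_pureHull.1 hg i hj.symm
  refine AddSubgroup.disjoint_def.2 fun {g} hg hg' => ?_
  exact h.eq_of_mem_pureHull hg (zero_mem _) ((hle hg').trans (by simp))

theorem isRankOne_pureHull (h : IsRingBasis t e A) (i : T) : IsRankOne (h.pureHull i) := by
  have : Nontrivial (h.pureHull i) :=
    ⟨⟨e i, h.basis_mem_pureHull i⟩, 0, fun hi => h.ne_zero i (congrArg Subtype.val hi)⟩
  exact isRankOne_of_injective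
    ((Pi.evalAddMonoidHom (fun _ : T => ℚ) i).comp (h.coord.comp (h.pureHull i).subtype))
    fun x y hxy => Subtype.ext (h.eq_of_mem_pureHull x.2 y.2 hxy)

theorem exists_summand_le_pureHull (h : IsRingBasis t e A) (ht : IsRigidFamily t)
    {H : AddSubgroup G} (hH : ∃ N : ℕ, N ≠ 0 ∧ ∀ g : G, N • g ∈ H) (D : CompleteDecomposition H)
    (k : Fin D.k) : ∃ i, (D.summand k).map H.subtype ≤ h.pureHull i := by
  -- As an endomorphism of `G`, the projection onto the summand after multiplication by `N` is
  -- diagonal, so that some `f (e i)` is nonzero and lies both in the summand and in the pure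
  -- hull of `e i`.
  obtain ⟨N, hN0, hN⟩ := hH
  let f : G →+ G :=
    H.subtype.comp ((D.projection k).comp ((nsmulAddMonoidHom N).codRestrict H hN))
  have := (D.rankOne k).nontrivial
  obtain ⟨⟨x, hx⟩, hx0⟩ := exists_ne (0 : D.summand k)
  have hfx : f x = N • (x : G) := congrArg H.subtype (D.projection_of_mem (nsmul_mem hx N))
  have hfx0 : f x ≠ 0 := by
    rw [hfx]
    exact smul_ne_zero hN0 fun hc => hx0 (Subtype.ext (Subtype.ext hc))
  obtain ⟨i, hi⟩ : ∃ i, h.coord (f x) i ≠ 0 :=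
    Function.ne_iff.1 ((map_ne_zero_iff _ h.coord_injective).2 hfx0)
  have hfe : f (e i) ≠ 0 := by
    rw [h.coord_map ht] at hi
    exact fun hc => left_ne_zero_of_mul hi (by rw [diagonal, hc, map_zero, Pi.zero_apply])
  refine ⟨i, ?_⟩
  rintro _ ⟨y, hy, rfl⟩
  obtain ⟨n, l, hn, hnl⟩ := (D.rankOne k).exists_zsmul_eq
    (x := ⟨D.projection k ⟨N • e i, hN _⟩, D.projection_mem k _⟩)
    (fun hc => hfe (congrArg (fun z : D.summand k => ((z : H) : G)) hc)) ⟨y, hy⟩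
  have hny : n • (y : G) = l • f (e i) := congrArg (fun z : D.summand k => ((z : H) : G)) hnl
  refine h.mem_pureHull_of_zsmul_mem hn ?_
  rw [AddSubgroup.coe_subtype, hny]
  exact zsmul_mem (h.map_mem_pureHull ht f (h.basis_mem_pureHull i)) l

theorem le_iSup_pureHull (h : IsRingBasis t e A) (ht : IsRigidFamily t) {H : AddSubgroup G}
    [H.FiniteIndex] (hcd : IsCD H) : H ≤ ⨆ i, h.pureHull i := by
  obtain ⟨D⟩ := hcd
  intro g hg
  have hsum := congrArg H.subtype (D.sum_projection ⟨g, hg⟩)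
  rw [map_sum] at hsum
  rw [← show _ = g from hsum]
  refine sum_mem fun k _ => ?_
  obtain ⟨i, hi⟩ := h.exists_summand_le_pureHull ht
    ⟨H.index, AddSubgroup.FiniteIndex.index_ne_zero, H.nsmul_index_mem⟩ D k
  exact AddSubgroup.mem_iSup_of_mem i (hi (AddSubgroup.mem_map_of_mem _ (D.projection_mem k _)))

theorem pureHull_le_regulator [Finite T] (h : IsRingBasis t e A) (ht : IsRigidFamily t) (i : T) :
    h.pureHull i ≤ regulator G := by
  refine le_sInf fun H ⟨hcd, hfin, hmin⟩ => ?_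
  have hle : H ≤ ⨆ i, h.pureHull i := h.le_iSup_pureHull ht hcd
  suffices H = ⨆ i, h.pureHull i from this ▸ le_iSup h.pureHull i
  by_contra hne
  refine (AddSubgroup.index_strictAnti (lt_of_le_of_ne hle hne)).not_ge (hmin _ ?_ ?_)
  · exact isCD_iSup h.iSupIndep_pureHull h.isRankOne_pureHull
  · exact AddSubgroup.finiteIndex_of_le hle

end IsRingBasis

/-! ### The components of the regulator -/

section RegPart

variable {G : Type*} [AddCommGroup G] {τ : GType}

theorem isCD_regulator_of_mem_critTypes (hτ : τ ∈ critTypes G) : IsCD (regulator G) := by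
  by_contra h
  exact hτ (by rw [regPart, dif_neg h])

theorem regPart_le_regulator (τ : GType) : regPart G τ ≤ regulator G := by
  rw [regPart]
  split_ifs
  · exact AddSubgroup.map_subtype_le _
  · exact bot_le

theorem isDivisibleBy_of_mem_regPart {g : G} (hg : g ∈ regPart G τ) :
    IsDivisibleBy τ.PInf g := by
  rw [regPart] at hg
  split_ifs at hg with hcd
  · obtain ⟨x, hx, rfl⟩ := hg
    refine IsDivisibleBy.map ?_ (regulator G).subtype
    refine AddSubgroup.iSup_induction (C := IsDivisibleBy τ.PInf) _ hx (fun i x hx => ?_)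
      isDivisibleBy_zero fun _ _ hx hy => hx.add hy
    exact (i.2.isDivisibleBy ⟨x, hx⟩).map (AddSubgroup.subtype _)
  · rw [AddSubgroup.mem_bot.1 hg]
    exact isDivisibleBy_zero

theorem mem_regPart_of_zsmul_mem [IsAddTorsionFree G] (hτ : τ ∈ critTypes G) {g : G}
    (hg : g ∈ regulator G) {n : ℤ} (hn : n ≠ 0) (h : n • g ∈ regPart G τ) : g ∈ regPart G τ := by
  have hcd := isCD_regulator_of_mem_critTypes hτ
  rw [regPart, dif_pos hcd] at h ⊢
  obtain ⟨x, hx, hxg⟩ := h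
  obtain rfl : x = n • (⟨g, hg⟩ : regulator G) := Subtype.ext hxg
  exact ⟨_, CompleteDecomposition.mem_part_of_zsmul_mem _ hn hx, rfl⟩

theorem mInv_ne_zero (hG : IsACD G) {d : G} (hd : IsRegGenerator d) (τ : GType) :
    mInv G τ ≠ 0 := by
  rw [mInv, dif_pos ⟨d, hd⟩]
  refine (IsOfFinAddOrder.addOrderOf_pos (isOfFinAddOrder_iff_nsmul_eq_zero.2 ?_)).ne'
  obtain ⟨n, hn, hmem⟩ := exists_nsmul_mem_map_toHull hG.exists_nsmul_mem_regulator
    (proj G τ (toHull G (Exists.choose ⟨d, hd⟩)))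
  refine ⟨n, Nat.pos_of_ne_zero hn, ?_⟩
  rwa [← QuotientAddGroup.mk_nsmul, QuotientAddGroup.eq_zero_iff]

instance : Finite (critTypes G) := (critTypes_finite G).to_subtype

instance : Finite (critTypes₀ G) := ((critTypes_finite G).subset fun _ hτ => hτ.1).to_subtype

variable {e : critTypes G → G} {e₀ : critTypes₀ G → G}

theorem IsRBasis.ne_zero (he : IsRBasis e e₀) (hG : IsACD G)
    (ht : IsRigidFamily ((↑) : critTypes G → GType)) (τ : critTypes G) : e τ ≠ 0 := by
  intro hτ
  have := hG.torsionFree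
  have h : IsRingBasis (fun σ : {σ : critTypes G // cyc σ (e σ) ≠ ⊥} => (σ : GType))
      (fun σ => e σ) (regulator G) :=
    { ne_zero := fun σ => mt cyc_eq_bot_iff.2 σ.2
      independent := he.independent.comp Subtype.val_injective
      iSup_cyc := (iSup_ne_bot_subtype _).trans he.sum_eq
      exists_nsmul_mem := hG.exists_nsmul_mem_regulator }
  refine τ.2 ((AddSubgroup.eq_bot_iff_forall _).2 fun g hg => h.coord_injective ?_)
  funext σ
  rw [map_zero, Pi.zero_apply]
  by_contra hne
  have hsub := h.pInf_subset_of_coord_ne_zero (isDivisibleBy_of_mem_regPart hg) hne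
  refine ht (fun hτσ => σ.2 ?_) hsub
  rw [← hτσ, hτ, cyc_eq_bot_iff]

theorem IsRBasis.isRingBasis (he : IsRBasis e e₀) (hG : IsACD G)
    (ht : IsRigidFamily ((↑) : critTypes G → GType)) : IsRingBasis (↑) e (regulator G) where
  ne_zero := he.ne_zero hG ht
  independent := he.independent
  iSup_cyc := he.sum_eq
  exists_nsmul_mem := hG.exists_nsmul_mem_regulator

theorem IsRBasis.mem_regPart_iff [IsAddTorsionFree G] (he : IsRBasis e e₀)
    (h : IsRingBasis (↑) e (regulator G)) (ht : IsRigidFamily ((↑) : critTypes G → GType))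
    {τ : critTypes G} {g : G} : g ∈ regPart G τ ↔ g ∈ h.pureHull τ := by
  refine ⟨fun hg => h.mem_pureHull_of_isDivisibleBy ht (isDivisibleBy_of_mem_regPart hg),
    fun hg => ?_⟩
  refine mem_regPart_of_zsmul_mem τ.2 (h.pureHull_le_regulator ht τ hg)
    (Int.natCast_ne_zero.2 (h.coord g τ).den_nz) ?_
  rw [natCast_zsmul, h.den_nsmul_eq_num_zsmul_basis hg]
  exact zsmul_mem (he.mem_part τ) _

end RegPart

/-! ### Endomorphisms and multiplications in coordinates -/

namespace IsRingBasis

variable {G : Type*} [AddCommGroup G] [IsAddTorsionFree G] {T : Type*} {t : T → GType} {e : T → G}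
  {A : AddSubgroup G}

theorem exists_coord_comp_eq (h : IsRingBasis t e A) {H : Type*} [AddCommGroup H]
    (φ : H →+ (T → ℚ)) (hφ : ∀ x, φ x ∈ h.coord.range) :
    ∃ f : H →+ G, ∀ x, h.coord (f x) = φ x := by
  choose f hf using hφ
  exact ⟨AddMonoidHom.mk' f fun x y => h.coord_injective (by simp only [hf, map_add]), hf⟩

/-- The structure constants `u i` of a multiplication: `e i × e i = u i • e i` in the hull of
`G`. -/
noncomputable def structureConstants (h : IsRingBasis t e A) (μ : Mult G) : T → ℚ :=
  fun i => h.coord (μ (e i ⊗ₜ e i)) i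

theorem coord_mult (h : IsRingBasis t e A) (ht : IsRigidFamily t) (μ : Mult G) (x y : G) :
    h.coord (μ (x ⊗ₜ y)) = h.structureConstants μ * h.coord x * h.coord y := by
  funext i
  have hleft := congrFun (h.coord_map ht
    (μ.toAddMonoidHom.comp ((TensorProduct.mk ℤ G G).flip y).toAddMonoidHom) x) i
  have hright := congrFun (h.coord_map ht
    (μ.toAddMonoidHom.comp (TensorProduct.mk ℤ G G (e i)).toAddMonoidHom) y) i
  change h.coord (μ (x ⊗ₜ y)) i = h.coord (μ (e i ⊗ₜ y)) i * h.coord x i at hleft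
  change h.coord (μ (e i ⊗ₜ y)) i = h.structureConstants μ i * h.coord y i at hright
  rw [hleft, hright, Pi.mul_apply, Pi.mul_apply]
  ring

theorem mult_mem_pureHull (h : IsRingBasis t e A) (ht : IsRigidFamily t) (μ : Mult G) (x : G)
    (i : T) : μ (x ⊗ₜ e i) ∈ h.pureHull i := h.mem_pureHull.2 fun j hj => by
  rw [h.coord_mult ht, Pi.mul_apply, h.coord_basis_of_ne hj, mul_zero]

theorem mult_ext (h : IsRingBasis t e A) (ht : IsRigidFamily t) {μ ν : Mult G}
    (hμν : ∀ i, μ (e i ⊗ₜ e i) = ν (e i ⊗ₜ e i)) : μ = ν := by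
  have hu : h.structureConstants μ = h.structureConstants ν :=
    funext fun i => congrFun (congrArg h.coord (hμν i)) i
  exact TensorProduct.ext' fun x y => h.coord_injective <|
    (h.coord_mult ht μ x y).trans (hu ▸ (h.coord_mult ht ν x y).symm)

theorem diagonal_mul_diagonal_symm (h : IsRingBasis t e A) (ht : IsRigidFamily t) (f : G ≃+ G) :
    h.diagonal (f : G →+ G) * h.diagonal (f.symm : G →+ G) = 1 := by
  funext i
  have hfe := congrFun (h.coord_map ht (f : G →+ G) (f.symm (e i))) i
  change h.coord (f (f.symm (e i))) i = (h.diagonal f * h.diagonal f.symm) i at hfe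
  rw [← hfe, f.apply_symm_apply, h.coord_basis_self, Pi.one_apply]

theorem structureConstants_eq_of_isomorphism (h : IsRingBasis t e A) (ht : IsRigidFamily t)
    {μ ν : Mult G} (f : G ≃+ G) (hf : ∀ x y : G, f (μ (x ⊗ₜ y)) = ν (f x ⊗ₜ f y)) :
    h.structureConstants μ = h.diagonal (f : G →+ G) * h.structureConstants ν := by
  funext i
  have hfi := congrFun (congrArg h.coord (hf (e i) (e i))) i
  rw [h.coord_mult ht] at hfi
  have hmap := congrFun (h.coord_map ht (f : G →+ G) (μ (e i ⊗ₜ e i))) i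
  have hne := left_ne_zero_of_mul_eq_one (congrFun (h.diagonal_mul_diagonal_symm ht f) i)
  refine mul_left_cancel₀ hne (hmap.symm.trans (hfi.trans ?_))
  change _ * h.diagonal (f : G →+ G) i * h.diagonal (f : G →+ G) i = _
  rw [Pi.mul_apply]
  ring

end IsRingBasis

/-! ### Cyclic extensions -/

/-- A group `G = ⟨d, A⟩` such that the subgroup `A = ⨁ R_{t i} e i` is given by a rigid family of
types and contains the pure hulls of the `e i`; here `d = ∑ (s i / m i) e i` with reduced
fractions. -/
structure IsCyclicExtension {G T : Type*} [AddCommGroup G] [IsAddTorsionFree G] (t : T → GType)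
    (e : T → G) (A : AddSubgroup G) (d : G) (s m : T → ℤ) : Prop extends IsRingBasis t e A where
  isRigidFamily : IsRigidFamily t
  pureHull_le : ∀ i, toIsRingBasis.pureHull i ≤ A
  m_ne_zero : ∀ i, m i ≠ 0
  isCoprime : ∀ i, IsCoprime (s i) (m i)
  coord_generator : ∀ i, toIsRingBasis.coord d i = s i / m i
  zmultiples_sup_eq_top : AddSubgroup.zmultiples d ⊔ A = ⊤

/-- The vectors `c` which are congruent to a common integer `k` modulo `m i R_{t i}` in each
coordinate. For the types and the `m_τ` of the definition of `K_G` this is membership in `K_G`. -/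
def IsMultiplier {T : Type*} (t : T → GType) (m : T → ℤ) (c : T → ℚ) : Prop :=
  ∃ k : ℤ, ∀ i, (c i - k) / m i ∈ (t i).R

/-- The vectors `u` with `u i = m i * v i`, where `v i ∈ R_{t i}` and the `s i * v i` are congruent
to a common integer `k` modulo `m i R_{t i}`. This describes the group `M_G(E₀)` without the
inverses of the `s i` modulo `m i`. -/
def IsStructureVector {T : Type*} (t : T → GType) (s m : T → ℤ) (u : T → ℚ) : Prop :=
  ∃ k : ℤ, ∀ i, u i / m i ∈ (t i).R ∧ (s i * (u i / m i) - k) / m i ∈ (t i).R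

theorem IsMultiplier.mem_R {T : Type*} {t : T → GType} {m : T → ℤ} {c : T → ℚ}
    (hm : ∀ i, m i ≠ 0) (hc : IsMultiplier t m c) (i : T) : c i ∈ (t i).R := by
  obtain ⟨k, hk⟩ := hc
  have hmi : (m i : ℚ) ≠ 0 := Int.cast_ne_zero.2 (hm i)
  have hci : c i = k + m i * ((c i - k) / m i) := by
    field_simp
    ring
  rw [hci]
  exact add_mem (intCast_mem _ _) (mul_mem (intCast_mem _ _) (hk i))

theorem isStructureVector_iff {T : Type*} {t : T → GType} {s m w : T → ℤ} {u : T → ℚ}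
    (hm : ∀ i, m i ≠ 0) (hw : ∀ i, m i ∣ s i * w i - 1) :
    IsStructureVector t s m u ↔
      ∃ k : ℤ, ∀ i, ∃ r ∈ (t i).R, u i = m i * (k * w i + m i * r) := by
  refine exists_congr fun k => forall_congr' fun i => ?_
  have hmi : (m i : ℚ) ≠ 0 := Int.cast_ne_zero.2 (hm i)
  have hz (z : ℤ) : (z : ℚ) ∈ (t i).R := intCast_mem _ z
  obtain ⟨z, hz_eq⟩ := hw i
  have hswz : (s i : ℚ) * w i = m i * z + 1 := by exact_mod_cast sub_eq_iff_eq_add.1 hz_eq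
  constructor
  · rintro ⟨hv, hr⟩
    refine ⟨w i * ((s i * (u i / m i) - k) / m i) - z * (u i / m i),
      sub_mem (mul_mem (hz _) hr) (mul_mem (hz _) hv), ?_⟩
    field_simp
    linear_combination (-u i) * hswz
  · rintro ⟨r, hr, hu⟩
    have hv : u i / m i = k * w i + m i * r := by rw [hu, mul_div_cancel_left₀ _ hmi]
    have hsv : (s i * (u i / m i) - k) / m i = k * z + s i * r := by
      rw [hv]
      field_simp
      linear_combination (k : ℚ) * hswz
    rw [hsv, hv]
    exact ⟨add_mem (mul_mem (hz k) (hz _)) (mul_mem (hz _) hr),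
      add_mem (mul_mem (hz k) (hz z)) (mul_mem (hz _) hr)⟩

theorem mul_mul_sub_mul_div_mem {R : Subring ℚ} {s m k l n : ℤ} {u x y : ℚ} (hm : m ≠ 0)
    (hv : u / m ∈ R) (hw : (s * (u / m) - k) / m ∈ R) (hx : x - l * (s / m) ∈ R)
    (hy : y - n * (s / m) ∈ R) : u * x * y - (l * n * k : ℤ) * (s / m) ∈ R := by
  have hmq : (m : ℚ) ≠ 0 := Int.cast_ne_zero.2 hm
  have huxy : u * x * y - (l * n * k : ℤ) * (s / m) =
      m * (u / m) * (x - l * (s / m)) * (y - n * (s / m)) +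
      u / m * ((s * l : ℤ) * (y - n * (s / m)) + (s * n : ℤ) * (x - l * (s / m))) +
      (l * n * s : ℤ) * ((s * (u / m) - k) / m) := by
    push_cast
    field_simp
    ring
  have hz (z : ℤ) : (z : ℚ) ∈ R := intCast_mem R z
  rw [huxy]
  exact add_mem (add_mem (mul_mem (mul_mem (mul_mem (hz m) hv) hx) hy)
    (mul_mem hv (add_mem (mul_mem (hz _) hy) (mul_mem (hz _) hx)))) (mul_mem (hz _) hw)

namespace IsCyclicExtension

variable {G : Type*} [AddCommGroup G] [IsAddTorsionFree G] {T : Type*} {t : T → GType} {e : T → G}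
  {A : AddSubgroup G} {d : G} {s m : T → ℤ}

theorem exists_coord_sub_mem_R (h : IsCyclicExtension t e A d s m) (g : G) :
    ∃ k : ℤ, ∀ i, h.coord g i - k * (s i / m i) ∈ (t i).R := by
  obtain ⟨_, ⟨k, rfl⟩, a, ha, rfl⟩ := AddSubgroup.mem_sup.1
    (h.zmultiples_sup_eq_top ▸ AddSubgroup.mem_top g)
  refine ⟨k, fun i => ?_⟩
  simpa [h.coord_generator] using h.coord_mem_R ha i

theorem mem_range_coord [Finite T] (h : IsCyclicExtension t e A d s m) {v : T → ℚ} (k : ℤ)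
    (hv : ∀ i, v i - k * (s i / m i) ∈ (t i).R) : v ∈ h.coord.range := by
  obtain ⟨a, -, ha⟩ := h.exists_mem_coord_eq hv
  refine ⟨k • d + a, funext fun i => ?_⟩
  simp [ha, h.coord_generator]

theorem coord_mem_R_of_mem_pureHull (h : IsCyclicExtension t e A d s m) {i : T} {g : G}
    (hg : g ∈ h.pureHull i) : h.coord g i ∈ (t i).R :=
  h.coord_mem_R (h.pureHull_le i hg) i

theorem isMultiplier_diagonal (h : IsCyclicExtension t e A d s m) (f : G →+ G) :
    IsMultiplier t m (h.diagonal f) := by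
  obtain ⟨k, hk⟩ := h.exists_coord_sub_mem_R (f d)
  refine ⟨k, fun i => div_mem_of_isCoprime (h.isCoprime i) (h.m_ne_zero i) ?_ ?_⟩
  · refine sub_mem (h.coord_mem_R_of_mem_pureHull ?_) (intCast_mem _ k)
    exact h.map_mem_pureHull h.isRigidFamily f (h.basis_mem_pureHull i)
  · have hki := hk i
    rwa [h.coord_map h.isRigidFamily, Pi.mul_apply, h.coord_generator, ← sub_mul] at hki

theorem exists_endomorphism [Finite T] (h : IsCyclicExtension t e A d s m) {c : T → ℚ}
    (hc : IsMultiplier t m c) : ∃ f : G →+ G, ∀ g, h.coord (f g) = c * h.coord g := by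
  have hcR := hc.mem_R h.m_ne_zero
  obtain ⟨k, hk⟩ := hc
  refine h.exists_coord_comp_eq ((AddMonoidHom.mulLeft c).comp h.coord) fun g => ?_
  obtain ⟨l, hl⟩ := h.exists_coord_sub_mem_R g
  refine h.mem_range_coord (k * l) fun i => ?_
  have hci : (c * h.coord g) i - (k * l : ℤ) * (s i / m i) =
      (l * s i : ℤ) * ((c i - k) / m i) + c i * (h.coord g i - l * (s i / m i)) := by
    rw [Pi.mul_apply]
    push_cast
    ring
  change (c * h.coord g) i - _ ∈ _
  rw [hci]
  exact add_mem (mul_mem (intCast_mem _ _) (hk i)) (mul_mem (hcR i) (hl i))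

theorem exists_automorphism [Finite T] (h : IsCyclicExtension t e A d s m) {c c' : T → ℚ}
    (hc : IsMultiplier t m c) (hc' : IsMultiplier t m c') (hcc : c * c' = 1) :
    ∃ f : G ≃+ G, ∀ g, h.coord (f g) = c * h.coord g := by
  obtain ⟨f, hf⟩ := h.exists_endomorphism hc
  obtain ⟨f', hf'⟩ := h.exists_endomorphism hc'
  refine ⟨AddMonoidHom.toAddEquiv f f' (AddMonoidHom.ext fun g => h.coord_injective ?_)
    (AddMonoidHom.ext fun g => h.coord_injective ?_), hf⟩
  · change h.coord (f' (f g)) = h.coord g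
    rw [hf', hf, ← mul_assoc, mul_comm c', hcc, one_mul]
  · change h.coord (f (f' g)) = h.coord g
    rw [hf, hf', ← mul_assoc, hcc, one_mul]

theorem isStructureVector_structureConstants (h : IsCyclicExtension t e A d s m) (μ : Mult G) :
    IsStructureVector t s m (h.structureConstants μ) := by
  obtain ⟨k, hk⟩ := h.exists_coord_sub_mem_R (μ (d ⊗ₜ d))
  refine ⟨k, fun i => ?_⟩
  have hu : h.structureConstants μ i ∈ (t i).R :=
    h.coord_mem_R_of_mem_pureHull (h.mult_mem_pureHull h.isRigidFamily μ _ i)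
  have hde := h.coord_mem_R_of_mem_pureHull (h.mult_mem_pureHull h.isRigidFamily μ d i)
  have hdd := hk i
  simp only [h.coord_mult h.isRigidFamily, Pi.mul_apply, h.coord_generator, h.coord_basis_self,
    mul_one] at hde hdd
  have hv := div_mem_of_isCoprime (h.isCoprime i) (h.m_ne_zero i) hu hde
  refine ⟨hv, div_mem_of_isCoprime (h.isCoprime i) (h.m_ne_zero i) ?_ ?_⟩
  · exact sub_mem (mul_mem (intCast_mem _ _) hv) (intCast_mem _ _)
  · convert hdd using 1
    ring

theorem exists_mult [Finite T] (h : IsCyclicExtension t e A d s m) {u : T → ℚ}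
    (hu : IsStructureVector t s m u) :
    ∃ μ : Mult G, ∀ x y, h.coord (μ (x ⊗ₜ y)) = u * h.coord x * h.coord y := by
  obtain ⟨k, hk⟩ := hu
  let φ : G ⊗[ℤ] G →ₗ[ℤ] (T → ℚ) := LinearMap.mulLeft ℤ u ∘ₗ LinearMap.mul' ℤ (T → ℚ) ∘ₗ
    TensorProduct.map h.coord.toIntLinearMap h.coord.toIntLinearMap
  have hφ : ∀ x y, φ (x ⊗ₜ y) = u * h.coord x * h.coord y := fun x y => (mul_assoc _ _ _).symm
  have hrange : ∀ z, φ z ∈ h.coord.range := fun z => by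
    induction z using TensorProduct.induction_on with
    | zero => exact map_zero φ ▸ zero_mem _
    | add z z' hz hz' => exact map_add φ z z' ▸ add_mem hz hz'
    | tmul x y =>
      obtain ⟨l, hl⟩ := h.exists_coord_sub_mem_R x
      obtain ⟨n, hn⟩ := h.exists_coord_sub_mem_R y
      refine h.mem_range_coord (l * n * k) fun i => ?_
      rw [hφ]
      exact mul_mul_sub_mul_div_mem (h.m_ne_zero i) (hk i).1 (hk i).2 (hl i) (hn i)
  obtain ⟨μ, hμ⟩ := h.exists_coord_comp_eq φ.toAddMonoidHom hrange
  exact ⟨μ.toIntLinearMap, fun x y => (hμ _).trans (hφ x y)⟩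

theorem exists_mult_iff [Finite T] (h : IsCyclicExtension t e A d s m) {U : T → G} :
    (∃ μ : Mult G, ∀ i, μ (e i ⊗ₜ e i) = U i) ↔
      (∀ i, U i ∈ h.pureHull i) ∧ IsStructureVector t s m fun i => h.coord (U i) i := by
  constructor
  · rintro ⟨μ, hμ⟩
    obtain rfl : (fun i => μ (e i ⊗ₜ e i)) = U := funext hμ
    exact ⟨fun i => h.mult_mem_pureHull h.isRigidFamily μ _ i,
      h.isStructureVector_structureConstants μ⟩
  · rintro ⟨hU, hu⟩
    obtain ⟨μ, hμ⟩ := h.exists_mult hu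
    refine ⟨μ, fun i => h.eq_of_mem_pureHull (h.mult_mem_pureHull h.isRigidFamily μ _ i) (hU i) ?_⟩
    simp [hμ]

theorem ringsIsomorphic_iff [Finite T] (h : IsCyclicExtension t e A d s m) (μ ν : Mult G) :
    RingsIsomorphic μ ν ↔ ∃ c c' : T → ℚ, IsMultiplier t m c ∧ IsMultiplier t m c' ∧ c * c' = 1 ∧
      h.structureConstants μ = c * h.structureConstants ν := by
  constructor
  · rintro ⟨f, hf⟩
    exact ⟨_, _, h.isMultiplier_diagonal f, h.isMultiplier_diagonal f.symm,
      h.diagonal_mul_diagonal_symm h.isRigidFamily f,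
      h.structureConstants_eq_of_isomorphism h.isRigidFamily f hf⟩
  · rintro ⟨c, c', hc, hc', hcc, hu⟩
    obtain ⟨f, hf⟩ := h.exists_automorphism hc hc' hcc
    refine ⟨f, fun x y => h.coord_injective ?_⟩
    rw [hf, h.coord_mult h.isRigidFamily, h.coord_mult h.isRigidFamily, hf, hf, hu]
    ring

end IsCyclicExtension

/-! ### The group `M_G(E₀)` and the ring `K_G` -/

section RBasis

variable {G : Type*} [AddCommGroup G] {e : critTypes G → G} {e₀ : critTypes₀ G → G}
  {s : critTypes₀ G → ℤ} {G₁ : AddSubgroup G} {d : G}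

open Classical in
/-- The numerators `s_τ`, extended by `0` to all critical types. -/
noncomputable def extNum (s : critTypes₀ G → ℤ) (τ : critTypes G) : ℤ :=
  if h : (τ : GType) ∈ critTypes₀ G then s ⟨τ, h⟩ else 0

open Classical in
/-- The inverses `s_τ⁻¹` modulo `m_τ` as chosen in the definition of `M_G(E₀)`, extended by `0` to
all critical types. -/
noncomputable def extInv (s : critTypes₀ G → ℤ) (τ : critTypes G) : ℤ :=
  if h : (τ : GType) ∈ critTypes₀ G then
    (((s ⟨τ, h⟩ : ZMod (mInv G τ))⁻¹).val : ℤ) else 0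

theorem mInv_eq_one {τ : critTypes G} (hm : mInv G τ ≠ 0) (hτ : (τ : GType) ∉ critTypes₀ G) :
    mInv G τ = 1 := by
  by_contra h
  exact hτ ⟨τ.2, by lia⟩

theorem isCoprime_extNum_mInv (hs : ∀ τ : critTypes₀ G, IsCoprime (s τ) (mInv G τ : ℤ))
    {τ : critTypes G} (hm : mInv G τ ≠ 0) : IsCoprime (extNum s τ) (mInv G τ : ℤ) := by
  by_cases h : (τ : GType) ∈ critTypes₀ G
  · rw [extNum, dif_pos h]
    exact hs ⟨τ, h⟩
  · rw [mInv_eq_one hm h]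
    exact isCoprime_one_right

theorem dvd_extNum_mul_extInv_sub_one (hs : ∀ τ : critTypes₀ G, IsCoprime (s τ) (mInv G τ : ℤ))
    {τ : critTypes G} (hm : mInv G τ ≠ 0) :
    (mInv G τ : ℤ) ∣ extNum s τ * extInv s τ - 1 := by
  by_cases h : (τ : GType) ∈ critTypes₀ G
  · have : NeZero (mInv G τ) := ⟨hm⟩
    rw [extNum, extInv, dif_pos h, dif_pos h, ← ZMod.intCast_zmod_eq_zero_iff_dvd]
    push_cast
    rw [ZMod.natCast_zmod_val, ZMod.coe_int_mul_inv_eq_one (hs ⟨τ, h⟩), sub_self]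
  · rw [mInv_eq_one hm h, Nat.cast_one]
    exact one_dvd _

variable [IsAddTorsionFree G]

theorem IsRBasis.coord_generator (he : IsRBasis e e₀) (h : IsRingBasis (↑) e (regulator G))
    (hd : toHull G d = ∑ᶠ τ : critTypes₀ G, ((s τ : ℚ) / (mInv G τ : ℚ)) • toHull G (e₀ τ))
    (τ : critTypes G) : h.coord d τ = extNum s τ / mInv G τ := by
  have := Fintype.ofFinite (critTypes₀ G)
  have hterm (σ : critTypes₀ G) :
      h.hullBasis.coord τ (((s σ : ℚ) / mInv G σ) • toHull G (e₀ σ)) =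
        s σ / mInv G σ * h.coord (e ⟨σ, σ.2.1⟩) τ := by
    rw [map_smul, smul_eq_mul, he.extends_rc, IsRingBasis.coord_apply]
  have hzero {σ : critTypes₀ G} (hσ : (σ : GType) ≠ τ) : h.coord (e ⟨σ, σ.2.1⟩) τ = 0 :=
    h.coord_basis_of_ne fun hτ => hσ (congrArg Subtype.val hτ).symm
  rw [h.coord_apply, hd, finsum_eq_sum_of_fintype, map_sum]
  simp only [hterm]
  by_cases hτ : (τ : GType) ∈ critTypes₀ G
  · rw [Finset.sum_eq_single ⟨τ, hτ⟩, h.coord_basis_self, mul_one, extNum, dif_pos hτ]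
    · intro σ _ hσ
      rw [hzero fun hστ => hσ (Subtype.ext hστ), mul_zero]
    · exact fun hmem => absurd (Finset.mem_univ _) hmem
  · rw [Finset.sum_eq_zero, extNum, dif_neg hτ, Int.cast_zero, zero_div]
    intro σ _
    rw [hzero fun hστ => hτ (hστ ▸ σ.2), mul_zero]

theorem IsRBasis.isCyclicExtension (he : IsRBasis e e₀) (hG : InA0 G) (he₀ : IsRCBasis G₁ d e₀ s) :
    IsCyclicExtension (↑) e (regulator G) d (extNum s) fun τ => (mInv G τ : ℤ) := by
  have ht := hG.blockRigid.isRigidFamily hG.ringType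
  have h := he.isRingBasis hG.crq.1 ht
  have hm (τ : critTypes G) := mInv_ne_zero hG.crq.1 he₀.generator τ
  exact
    { h with
      isRigidFamily := ht
      pureHull_le := fun τ => h.pureHull_le_regulator ht τ
      m_ne_zero := fun τ => Int.natCast_ne_zero.2 (hm τ)
      isCoprime := fun τ => isCoprime_extNum_mInv he₀.coprime (hm τ)
      coord_generator := fun τ => by
        rw [he.coord_generator h he₀.standard_rep, Int.cast_natCast]
      zmultiples_sup_eq_top := he₀.generator }

theorem IsRBasis.coord_elemX (he : IsRBasis e e₀) (h : IsRingBasis (↑) e (regulator G))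
    (τ : critTypes G) : h.coord (elemX e₀ s τ) τ = mInv G τ * extInv s τ := by
  rw [elemX, extInv]
  split_ifs with hτ
  · rw [← he.extends_rc, map_nsmul, Pi.smul_apply, h.coord_basis_self, nsmul_eq_mul]
    push_cast
    ring
  · simp

theorem IsRBasis.elemX_mem_pureHull (he : IsRBasis e e₀) (h : IsRingBasis (↑) e (regulator G))
    (τ : critTypes G) : elemX e₀ s τ ∈ h.pureHull τ := by
  rw [elemX]
  split_ifs
  · rw [← he.extends_rc]
    exact nsmul_mem (h.basis_mem_pureHull τ) _
  · exact zero_mem _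

theorem IsRBasis.mem_groupM_iff_coord (he : IsRBasis e e₀) (h : IsRingBasis (↑) e (regulator G))
    (ht : IsRigidFamily ((↑) : critTypes G → GType)) {U : critTypes G → G} :
    U ∈ groupM e₀ s ↔ (∀ τ, U τ ∈ h.pureHull τ) ∧
      ∃ k : ℤ, ∀ τ : critTypes G, ∃ r ∈ (τ : GType).R,
        h.coord (U τ) τ = mInv G τ * (k * extInv s τ + mInv G τ * r) := by
  have hcoord (k : ℤ) (y : critTypes G → G) (τ : critTypes G) :
      h.coord (k • elemX e₀ s τ + mInv G τ ^ 2 • y τ) τ =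
        mInv G τ * (k * extInv s τ + mInv G τ * h.coord (y τ) τ) := by
    rw [map_add, map_zsmul, map_nsmul, Pi.add_apply, Pi.smul_apply, Pi.smul_apply,
      he.coord_elemX h, zsmul_eq_mul, nsmul_eq_mul]
    push_cast
    ring
  have hmem (k : ℤ) {y : critTypes G → G} (hy : ∀ τ, y τ ∈ h.pureHull τ) (τ : critTypes G) :
      k • elemX e₀ s τ + mInv G τ ^ 2 • y τ ∈ h.pureHull τ :=
    add_mem (zsmul_mem (he.elemX_mem_pureHull h τ) k) (nsmul_mem (hy τ) _)
  constructor
  · intro hU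
    obtain ⟨_, ⟨k, rfl⟩, Y, hY, rfl⟩ := AddSubgroup.mem_sup.1 hU
    choose y hy hyY using fun τ => hY τ trivial
    obtain rfl : (fun τ : critTypes G => mInv G τ ^ 2 • y τ) = Y := funext hyY
    exact ⟨hmem k fun τ => (he.mem_regPart_iff h ht).1 (hy τ), k, fun τ =>
      ⟨_, h.coord_mem_R (regPart_le_regulator _ (hy τ)) τ, hcoord k y τ⟩⟩
  · rintro ⟨hU, k, hk⟩
    choose r hr hUr using hk
    choose y hy hyr using fun τ => h.exists_mem_pureHull_coord_eq (hr τ)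
    refine AddSubgroup.mem_sup.2 ⟨_, ⟨k, rfl⟩, fun τ => mInv G τ ^ 2 • y τ,
      fun τ _ => ⟨y τ, (he.mem_regPart_iff h ht).2 (hy τ), rfl⟩, funext fun τ => ?_⟩
    refine h.eq_of_mem_pureHull (hmem k hy τ) (hU τ) ((hcoord k y τ).trans ?_)
    rw [hUr, hyr]

theorem IsRBasis.mem_groupM_iff (he : IsRBasis e e₀)
    (h : IsCyclicExtension (↑) e (regulator G) d (extNum s) fun τ => (mInv G τ : ℤ))
    (hs : ∀ τ : critTypes₀ G, IsCoprime (s τ) (mInv G τ : ℤ)) {U : critTypes G → G} :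
    U ∈ groupM e₀ s ↔ (∀ τ, U τ ∈ h.pureHull τ) ∧
      IsStructureVector (↑) (extNum s) (fun τ => (mInv G τ : ℤ)) fun τ => h.coord (U τ) τ := by
  rw [he.mem_groupM_iff_coord h.toIsRingBasis h.isRigidFamily, isStructureVector_iff h.m_ne_zero
    fun τ => dvd_extNum_mul_extInv_sub_one hs (Int.natCast_ne_zero.1 (h.m_ne_zero τ))]
  simp only [Int.cast_natCast]

end RBasis

section RingK

variable {G : Type*} [AddCommGroup G]

theorem mem_ringK_iff_isMultiplier (hm : ∀ τ : critTypes G, mInv G τ ≠ 0) {c : RingR G} :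
    c ∈ ringK G ↔ IsMultiplier (↑) (fun τ : critTypes G => (mInv G τ : ℤ)) fun τ => (c τ : ℚ) := by
  have hmq (τ : critTypes G) : (mInv G τ : ℚ) ≠ 0 := Nat.cast_ne_zero.2 (hm τ)
  constructor
  · intro hc
    obtain ⟨_, ⟨k, rfl⟩, y, hy, rfl⟩ := AddSubgroup.mem_sup.1 hc
    refine ⟨k, fun τ => ?_⟩
    obtain ⟨r, hr⟩ := hy τ trivial
    have hr : (y τ : ℚ) = mInv G τ * r := by
      rw [← hr]
      simp
    by_cases hτ : (τ : GType) ∈ critTypes₀ G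
    · simp [oneT₀, hτ, hr, hmq]
    · simp [oneT₀, hτ, hr, mInv_eq_one (hm τ) hτ, sub_mem]
  · rintro ⟨k, hk⟩
    refine AddSubgroup.mem_sup.2 ⟨_, ⟨k, rfl⟩, c - k • oneT₀ G, fun τ _ => ?_,
      add_sub_cancel _ _⟩
    by_cases hτ : (τ : GType) ∈ critTypes₀ G
    · refine ⟨⟨_, hk τ⟩, Subtype.ext ?_⟩
      simp [oneT₀, hτ, mul_div_cancel₀, hmq]
    · refine ⟨c τ, Subtype.ext ?_⟩
      simp [oneT₀, hτ, mInv_eq_one (hm τ) hτ]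

theorem exists_mem_unitsK_iff (hm : ∀ τ : critTypes G, mInv G τ ≠ 0)
    {p : (critTypes G → ℚ) → Prop} :
    (∃ c ∈ unitsK G, p fun τ => (c τ : ℚ)) ↔ ∃ c c' : critTypes G → ℚ,
      IsMultiplier (↑) (fun τ : critTypes G => (mInv G τ : ℤ)) c ∧
      IsMultiplier (↑) (fun τ : critTypes G => (mInv G τ : ℤ)) c' ∧ c * c' = 1 ∧ p c := by
  constructor
  · rintro ⟨c, ⟨hc, c', hc', hcc⟩, hp⟩
    exact ⟨_, _, (mem_ringK_iff_isMultiplier hm).1 hc, (mem_ringK_iff_isMultiplier hm).1 hc',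
      funext fun τ => congrArg Subtype.val (congrFun hcc τ), hp⟩
  · rintro ⟨c, c', hc, hc', hcc, hp⟩
    have hm' (τ : critTypes G) : (mInv G τ : ℤ) ≠ 0 := Int.natCast_ne_zero.2 (hm τ)
    let a : RingR G := fun τ => ⟨c τ, hc.mem_R hm' τ⟩
    let a' : RingR G := fun τ => ⟨c' τ, hc'.mem_R hm' τ⟩
    have haa : a * a' = 1 := funext fun τ => Subtype.ext (congrFun hcc τ)
    exact ⟨a, ⟨(mem_ringK_iff_isMultiplier hm).2 hc, a', (mem_ringK_iff_isMultiplier hm).2 hc',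
      haa⟩, hp⟩

end RingK

end ACDGroup

theorem theorem2p4 {G : Type*} [AddCommGroup G] (hG : InA0 G) (hrigid : IsRigid G)
    (G₁ C : AddSubgroup G) (hmain : IsMainDecomposition G₁ C)
    (d : G) (e₀ : critTypes₀ G → G) (s : critTypes₀ G → ℤ) (he₀ : IsRCBasis G₁ d e₀ s)
    (e : critTypes G → G) (he : IsRBasis e e₀) :
    (Function.Injective (multVector e) ∧ (multVector e).range = groupM e₀ s) ∧
    ∀ Ustar ∈ groupM e₀ s, ∀ Utimes ∈ groupM e₀ s, ∀ star times : Mult G,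
      multVector e star = Ustar → multVector e times = Utimes →
      (RingsIsomorphic star times ↔
        ∃ c ∈ unitsK G, ∀ τ : critTypes G,
          toHull G (Ustar τ) = (c τ : ℚ) • toHull G (Utimes τ)) := by
  have : IsAddTorsionFree G := hG.crq.1.torsionFree
  have h := he.isCyclicExtension hG he₀
  have hm (τ : critTypes G) : mInv G τ ≠ 0 := mInv_ne_zero hG.crq.1 he₀.generator τ
  refine ⟨⟨fun μ ν hμν => h.mult_ext h.isRigidFamily (congrFun hμν), ?_⟩, ?_⟩
  · ext U
    rw [he.mem_groupM_iff h he₀.coprime, ← h.exists_mult_iff]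
    exact exists_congr fun μ => funext_iff
  · rintro _ - _ - μ ν rfl rfl
    have hsquare (μ : Mult G) (τ : critTypes G) : μ (e τ ⊗ₜ[ℤ] e τ) ∈ h.pureHull τ :=
      h.mult_mem_pureHull h.isRigidFamily μ (e τ) τ
    rw [h.ringsIsomorphic_iff, ← exists_mem_unitsK_iff hm]
    refine exists_congr fun c => and_congr_right fun _ => funext_iff.trans ?_
    exact forall_congr' fun τ => (h.toHull_eq_smul_iff (hsquare μ τ) (hsquare ν τ)).symm
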